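/- For a sequence $\mathbf{c}=(c_0,c_1,c_2,\ldots)$ of numbers and an integer $n\ge 0$, let $$H_n(c_k)=\det\big(c_{i+j}\big)_{0\le i,j\le n}$$ be its $n$th Hankel determinant (of an $(n+1)\times(n+1)$ matrix; the sequence begins with $k=0$). For integers $s\ge 1$ and $k\ge 0$ let $$S_k(s)=k\left(1+2^{k-1}+\cdots+s^{k-1}\right)=k\sum_{j=1}^{s}j^{k-1},$$ so that $S_0(s)=0$. Then for all integers $s\ge 1$ and $m\ge 0$ we have $$H_{2m}(S_k(s))=0$$ and $$H_{2m+1}(S_k(s))=(-s^2)^{m+1}\prod_{\ell=1}^{m}\left(\frac{\ell^4(s^2-\ell^2)}{4(2\ell+1)(2\ell-1)}\right)^{2(m+1-\ell)}.$$ In particular, $H_{2m+1}(S_k(s))=0$ whenever $m\ge s$. -/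

import Mathlib

/-- The Hankel determinant `H_n(c) = det (c_{i+j})_{0 ≤ i, j ≤ n}` of a sequence `c`;
the underlying matrix has size `n + 1`. -/
def hankelDet {R : Type*} [CommRing R] (c : ℕ → R) (n : ℕ) : R :=
  (Matrix.of fun i j : Fin (n + 1) => c ((i : ℕ) + (j : ℕ))).det

/-- The number `S_k(s) = k (1 ^ (k - 1) + 2 ^ (k - 1) + ⋯ + s ^ (k - 1))`. The exponent is the
integer `k - 1`, so that for `k = 0` the bracket is `1 + 1 / 2 + ⋯ + 1 / s` and `S_0(s) = 0`. -/
def weightedPowerSum (s k : ℕ) : ℚ :=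
  (k : ℚ) * ∑ j ∈ Finset.Icc 1 s, (j : ℚ) ^ ((k : ℤ) - 1)

/-! With `c = (s + 1) / 2`, `S_k(s)` is the moment `L((X + c) ^ k)` of the functional `L = derivSum
s`, so the Hankel matrix may be replaced by the Gram matrix of `L` in any monic basis, and the shift
by `c` disappears.

As the nodes are symmetric, `L` kills even polynomials. In a basis of alternating parity the Gram
matrix is a checkerboard: singular in odd size, and in even size, up to sign, the square of one
block determinant.

For even elements `∏ (X² - (a + l)²)` and odd ones `X ∏ (X² - (b + l)²)`, with `a, b = (1 ± s) / 2`,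
that block is a Hilbert matrix with rescaled rows and columns (`derivSum_X_mul`). This rests on a
two-term recurrence, obtained by telescoping. The Hilbert recursion then gives the product. -/

open Polynomial

/-! ### Checkerboard and Hilbert determinants -/

namespace Matrix

/-- The determinant of a block anti-diagonal matrix. -/
theorem det_fromBlocks_zero₁₁_zero₂₂ {n R : Type*} [Fintype n] [DecidableEq n] [CommRing R]
    (B C : Matrix n n R) :
    (fromBlocks 0 B C 0).det = (-1) ^ Fintype.card n * (B.det * C.det) := by
  have h1 : (fromBlocks 0 1 1 0 : Matrix (n ⊕ n) (n ⊕ n) R).det = (-1) ^ Fintype.card n := by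
    have h2 : (fromBlocks 1 1 0 1 : Matrix (n ⊕ n) (n ⊕ n) R) * fromBlocks 0 1 1 0 =
        fromBlocks 1 1 1 0 := by
      simp [fromBlocks_multiply]
    have h3 := congrArg det h2
    rw [det_mul, det_fromBlocks_zero₂₁, det_fromBlocks_one₁₁] at h3
    simpa [det_neg] using h3
  have h4 : (fromBlocks 0 B C 0 : Matrix (n ⊕ n) (n ⊕ n) R) =
      fromBlocks B 0 0 C * fromBlocks 0 1 1 0 := by
    simp [fromBlocks_multiply]
  rw [h4, det_mul, det_fromBlocks_zero₂₁, h1, mul_comm]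

/-- A checkerboard matrix (zero where the indices have equal parity) of odd size is singular. -/
theorem det_checkerboard_odd (N : ℕ → ℕ → ℚ) (hN : ∀ i j, Even (i + j) → N i j = 0) (m : ℕ) :
    (of fun i j : Fin (2 * m + 1) => N i j).det = 0 := by
  -- Conjugation by the diagonal matrix of signs `(-1) ^ i` negates the matrix but keeps its
  -- determinant; in odd size negation flips the sign.
  have h : (of fun i j : Fin (2 * m + 1) => N i j).det =
      (-1) * (of fun i j : Fin (2 * m + 1) => N i j).det := by
    have h1 : (of fun i j : Fin (2 * m + 1) => (-1 : ℚ) ^ (i : ℕ) * ((-1) ^ (j : ℕ) * N i j)) =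
        -(of fun i j : Fin (2 * m + 1) => N i j) := by
      ext i j
      simp only [of_apply, neg_apply]
      rcases Nat.even_or_odd ((i : ℕ) + j) with h | h
      · simp [hN _ _ h]
      · rw [← mul_assoc, ← pow_add, h.neg_one_pow, neg_one_mul]
    have h2 := congrArg det h1
    have h3 := det_mul_column (fun i : Fin (2 * m + 1) => (-1 : ℚ) ^ (i : ℕ))
      (of fun i j : Fin (2 * m + 1) => (-1) ^ (j : ℕ) * N i j)
    have h4 := det_mul_row (fun i : Fin (2 * m + 1) => (-1 : ℚ) ^ (i : ℕ))
      (of fun i j : Fin (2 * m + 1) => N i j)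
    simp only [of_apply] at h3 h4
    rw [h3, h4, ← mul_assoc, ← Finset.prod_mul_distrib, det_neg] at h2
    simpa [← pow_add, Even.neg_one_pow, pow_succ, pow_mul] using h2
  linarith

/-- The determinant of a checkerboard matrix of even size. -/
theorem det_checkerboard_even {R : Type*} [CommRing R] (N : ℕ → ℕ → R)
    (hN : ∀ i j, Even (i + j) → N i j = 0) (m : ℕ) :
    (of fun i j : Fin (2 * m) => N i j).det =
      (-1) ^ m * ((of fun i j : Fin m => N (2 * i) (2 * j + 1)).det *
        (of fun i j : Fin m => N (2 * i + 1) (2 * j)).det) := by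
  let f : Fin m ⊕ Fin m → Fin (2 * m) :=
    Sum.elim (fun i => ⟨2 * i, by omega⟩) (fun i => ⟨2 * i + 1, by omega⟩)
  have hf : Function.Bijective f := by
    rw [Fintype.bijective_iff_injective_and_card]
    constructor
    · rintro (i | i) (j | j) h <;> simp only [f, Sum.elim_inl, Sum.elim_inr, Fin.mk.injEq] at h
      · exact congrArg _ (Fin.ext (by omega))
      · omega
      · omega
      · exact congrArg _ (Fin.ext (by omega))
    · simp [two_mul]
  rw [← det_submatrix_equiv_self (Equiv.ofBijective f hf)]
  have : (of fun i j : Fin (2 * m) => N i j).submatrix (Equiv.ofBijective f hf)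
      (Equiv.ofBijective f hf) = fromBlocks 0 (of fun i j : Fin m => N (2 * i) (2 * j + 1))
        (of fun i j : Fin m => N (2 * i + 1) (2 * j)) 0 := by
    ext (i | i) (j | j)
    · simpa [f] using hN (2 * i) (2 * j) (by simp [parity_simps])
    · simp [f]
    · simp [f]
    · simpa [f] using hN (2 * i + 1) (2 * j + 1) (by simp [parity_simps])
  rw [this, det_fromBlocks_zero₁₁_zero₂₂, Fintype.card_fin]

/-- Pivoting on the last diagonal entry. -/
theorem det_succ_eq_last_mul {K : Type*} [Field K] {n : ℕ} (N : ℕ → ℕ → K) (h : N n n ≠ 0) :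
    (of fun i j : Fin (n + 1) => N i j).det =
      N n n * (of fun i j : Fin n => N i j - N i n * N n j / N n n).det := by
  rw [← det_submatrix_equiv_self (finSumFinEquiv (m := n) (n := 1))]
  have : (of fun i j : Fin (n + 1) => N i j).submatrix finSumFinEquiv finSumFinEquiv =
      fromBlocks (of fun i j : Fin n => N i j) (of fun (i : Fin n) (_ : Fin 1) => N i n)
        (of fun (_ : Fin 1) (j : Fin n) => N n j) (of fun _ _ : Fin 1 => N n n) := by
    ext (i | i) (j | j) <;> simp
  rw [this]
  have hd : (of fun _ _ : Fin 1 => N n n).det = N n n := by simp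
  have : Invertible (of fun _ _ : Fin 1 => N n n) :=
    invertibleOfIsUnitDet _ (by rw [hd]; exact h.isUnit)
  rw [det_fromBlocks₂₂, hd]
  congr 2
  ext i j
  simp [mul_apply, invOf_eq_nonsing_inv, Ring.inverse_eq_inv']
  field_simp

/-- The recursion for the determinants of the Hilbert matrices. -/
theorem det_hilbert_succ (n : ℕ) :
    (of fun i j : Fin (n + 1) => (1 : ℚ) / ((i : ℕ) + (j : ℕ) + 1)).det =
      (1 : ℚ) / (2 * n + 1) * (∏ i ∈ Finset.range n, ((n : ℚ) - i) / (n + i + 1)) ^ 2 *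
        (of fun i j : Fin n => (1 : ℚ) / ((i : ℕ) + (j : ℕ) + 1)).det := by
  have h0 := det_succ_eq_last_mul (n := n) (fun i j : ℕ => (1 : ℚ) / (i + j + 1))
    (by positivity)
  rw [h0]
  -- The Schur complement of the last entry is again a Hilbert matrix, with rows and columns
  -- rescaled.
  have h1 : (of fun i j : Fin n => (1 : ℚ) / ((i : ℕ) + (j : ℕ) + 1) -
      1 / ((i : ℕ) + (n : ℕ) + 1) * (1 / ((n : ℕ) + (j : ℕ) + 1)) /
        (1 / ((n : ℕ) + (n : ℕ) + 1))) =
      of fun i j : Fin n => ((n : ℚ) - (i : ℕ)) / (n + (i : ℕ) + 1) *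
        (((n : ℚ) - (j : ℕ)) / (n + (j : ℕ) + 1) * (1 / ((i : ℕ) + (j : ℕ) + 1))) := by
    ext i j
    simp only [of_apply]
    field_simp
    ring
  rw [h1]
  have h3 := det_mul_column (fun i : Fin n => ((n : ℚ) - (i : ℕ)) / (n + (i : ℕ) + 1))
    (of fun i j : Fin n => ((n : ℚ) - (j : ℕ)) / (n + (j : ℕ) + 1) *
      (1 / ((i : ℕ) + (j : ℕ) + 1)))
  have h4 := det_mul_row (fun i : Fin n => ((n : ℚ) - (i : ℕ)) / (n + (i : ℕ) + 1))
    (of fun i j : Fin n => (1 : ℚ) / ((i : ℕ) + (j : ℕ) + 1))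
  simp only [of_apply] at h3 h4
  rw [h3, h4, Fin.prod_univ_eq_prod_range (fun i : ℕ => ((n : ℚ) - i) / (n + i + 1)) n]
  ring

end Matrix

/-- A Hankel determinant of moments can be computed in any basis of monic polynomials. -/
theorem det_moment_eq_det_monic {R : Type*} [CommRing R] (L : R[X] →ₗ[R] R) {n : ℕ}
    (p : Fin n → R[X]) (hdeg : ∀ i, (p i).natDegree = i) (hp : ∀ i, (p i).Monic) :
    (Matrix.of fun i j : Fin n => L (X ^ ((i : ℕ) + j))).det =
      (Matrix.of fun i j : Fin n => L (p i * p j)).det := by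
  set P : Matrix (Fin n) (Fin n) R := Matrix.of fun i j => (p j).coeff i
  have hP : P.det = 1 := Matrix.det_matrixOfPolynomials p hdeg hp
  have hs : ∀ j, p j = ∑ k : Fin n, (p j).coeff k • (X : R[X]) ^ (k : ℕ) := fun j => by
    conv_lhs => rw [(p j).as_sum_range' n (by rw [hdeg]; exact j.2)]
    rw [← Fin.sum_univ_eq_sum_range (fun k => monomial k ((p j).coeff k)) n]
    exact Finset.sum_congr rfl fun k _ => by rw [smul_X_eq_monomial]
  have : (Matrix.of fun i j : Fin n => L (p i * p j)) =
      P.transpose * (Matrix.of fun i j : Fin n => L (X ^ ((i : ℕ) + j))) * P := by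
    ext i j
    simp only [Matrix.mul_apply, Matrix.of_apply, Matrix.transpose_apply, P]
    conv_lhs => rw [hs i, hs j]
    rw [Finset.sum_mul_sum]
    simp only [map_sum, Finset.sum_mul, smul_mul_smul_comm, map_smul, ← pow_add, smul_eq_mul]
    rw [Finset.sum_comm]
    exact Finset.sum_congr rfl fun k _ => Finset.sum_congr rfl fun l _ => by ring
  rw [this, Matrix.det_mul, Matrix.det_mul, Matrix.det_transpose, hP]
  ring

/-! ### The functional behind the weighted power sums -/

/-- The functional `f ↦ ∑ f'(t - (s + 1) / 2)`, `1 ≤ t ≤ s`, summing the derivative over `s`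
equidistant points that are symmetric about the origin. -/
noncomputable def derivSum (s : ℕ) : ℚ[X] →ₗ[ℚ] ℚ :=
  ∑ t ∈ Finset.Icc 1 s, (leval ((t : ℚ) - (s + 1) / 2)).comp derivative

theorem derivSum_apply (s : ℕ) (f : ℚ[X]) :
    derivSum s f = ∑ t ∈ Finset.Icc 1 s, (derivative f).eval ((t : ℚ) - (s + 1) / 2) := by
  simp [derivSum, LinearMap.sum_apply, leval_apply]

theorem weightedPowerSum_eq_derivSum (s k : ℕ) :
    weightedPowerSum s k = derivSum s ((X + C (((s : ℚ) + 1) / 2)) ^ k) := by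
  rw [derivSum_apply, weightedPowerSum, Finset.mul_sum]
  refine Finset.sum_congr rfl fun t _ => ?_
  rcases k with _ | k
  · simp
  · simp [derivative_X_add_C_pow]

theorem derivSum_eq_zero_of_even (s : ℕ) (f : ℚ[X]) (hf : f.comp (-X) = f) :
    derivSum s f = 0 := by
  have hd : ∀ x : ℚ, (derivative f).eval (-x) = -(derivative f).eval x := fun x => by
    have h := congrArg (fun g => (derivative g).eval x) hf
    simp only [derivative_comp, derivative_neg, derivative_X, eval_mul, eval_neg, eval_one,
      eval_comp, eval_X] at h
    linarith
  have h : derivSum s f = -derivSum s f := by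
    conv_lhs => rw [derivSum_apply]
    rw [derivSum_apply, ← Finset.sum_neg_distrib]
    refine Finset.sum_nbij' (fun t => s + 1 - t) (fun t => s + 1 - t) ?_ ?_ ?_ ?_ ?_
    · intro t ht; simp only [Finset.mem_Icc] at ht ⊢; omega
    · intro t ht; simp only [Finset.mem_Icc] at ht ⊢; omega
    · intro t ht; simp only [Finset.mem_Icc] at ht ⊢; omega
    · intro t ht; simp only [Finset.mem_Icc] at ht ⊢; omega
    · intro t ht
      simp only [Finset.mem_Icc] at ht
      rw [← hd, Nat.cast_sub (by omega)]
      congr 1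
      push_cast
      ring
  linarith

/-- The functional `derivSum` annihilates central differences of polynomials with double zeros
at the two outer endpoints. -/
theorem derivSum_centralDiff (s : ℕ) (h : ℚ[X]) (g : ℚ[X])
    (hg : g = (X ^ 2 - C ((s : ℚ) ^ 2 / 4)) ^ 2 * h) :
    derivSum s (g.comp (X + C (1 / 2)) - g.comp (X - C (1 / 2))) = 0 := by
  -- Telescoping with the centre fixed by `s`; at `n = s` the end terms are `g'(± s / 2)`, which
  -- vanish by the double zeros.
  have key : ∀ n : ℕ, ∑ t ∈ Finset.Icc 1 n,
      (derivative (g.comp (X + C (1 / 2)) - g.comp (X - C (1 / 2)))).eval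
        ((t : ℚ) - (s + 1) / 2) =
      (derivative g).eval ((n : ℚ) - s / 2) - (derivative g).eval (-(s : ℚ) / 2) := by
    intro n
    induction n with
    | zero => simp [neg_div]
    | succ n ih =>
      rw [Finset.sum_Icc_succ_top (by omega), ih]
      simp only [derivative_sub, derivative_comp, derivative_add, derivative_X, derivative_C,
        eval_sub, eval_mul, eval_comp, eval_add, eval_X, eval_C, eval_one, eval_zero]
      have h1 : ((n + 1 : ℕ) : ℚ) - (s + 1) / 2 - 1 / 2 = n - s / 2 := by push_cast; ring
      have h2 : ((n + 1 : ℕ) : ℚ) - (s + 1) / 2 + 1 / 2 = (n + 1 : ℕ) - s / 2 := by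
        push_cast; ring
      rw [h1, h2]
      ring
  have hz : ∀ x : ℚ, x ^ 2 = (s : ℚ) ^ 2 / 4 → (derivative g).eval x = 0 := by
    intro x hx
    rw [hg]
    simp [derivative_mul, derivative_pow, hx]
  rw [derivSum_apply, key, hz _ (by ring), hz _ (by ring), sub_zero]

/-! ### Even factorial polynomials and their moments -/

/-- The even polynomial `∏ (X² - (a + l)²)`, `l < i`. -/
noncomputable def evenPochhammer (a : ℚ) (i : ℕ) : ℚ[X] :=
  ∏ l ∈ Finset.range i, (X ^ 2 - C ((a + l) ^ 2))

theorem evenPochhammer_succ (a : ℚ) (i : ℕ) :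
    evenPochhammer a (i + 1) = evenPochhammer a i * (X ^ 2 - C ((a + i) ^ 2)) :=
  Finset.prod_range_succ _ _

theorem evenPochhammer_comp_neg (a : ℚ) (i : ℕ) :
    (evenPochhammer a i).comp (-X) = evenPochhammer a i := by
  simp [evenPochhammer, Polynomial.prod_comp]

theorem evenPochhammer_monic (a : ℚ) (i : ℕ) : (evenPochhammer a i).Monic :=
  monic_prod_of_monic _ _ fun _ _ => monic_X_pow_sub_C _ two_ne_zero

theorem evenPochhammer_natDegree (a : ℚ) (i : ℕ) : (evenPochhammer a i).natDegree = 2 * i := by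
  rw [evenPochhammer, natDegree_prod_of_monic _ _ fun _ _ => monic_X_pow_sub_C _ two_ne_zero]
  simp only [natDegree_X_pow_sub_C, Finset.sum_const, Finset.card_range, smul_eq_mul]
  ring

theorem evenPochhammer_succ_eq_mul (a : ℚ) (i : ℕ) :
    ∃ h, evenPochhammer a (i + 1) = (X ^ 2 - C (a ^ 2)) * h := by
  refine ⟨∏ l ∈ Finset.range i, (X ^ 2 - C ((a + (l + 1 : ℕ)) ^ 2)), ?_⟩
  rw [evenPochhammer, Finset.prod_range_succ', mul_comm]
  simp

/-- Each shifted factor splits as `(X + a + l) (X - a - l + 1)`; regrouping the linear factors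
leaves one unpaired at each end. -/
theorem evenPochhammer_comp_add_half (a : ℚ) (i : ℕ) :
    (evenPochhammer (a - 1 / 2) (i + 1)).comp (X + C (1 / 2)) =
      evenPochhammer a i * ((X + C a + C (i : ℚ)) * (X - C a + 1)) := by
  have hc : (C (1 / 2) : ℚ[X]) * 2 = 1 := by
    rw [show (2 : ℚ[X]) = C 2 from rfl, ← C_mul]; norm_num
  induction i with
  | zero =>
    simp only [evenPochhammer, zero_add, Finset.prod_range_one, Finset.prod_range_zero, sub_comp,
      pow_comp, X_comp, C_comp, Nat.cast_zero, add_zero, map_zero, C_pow, C_sub]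
    linear_combination (X + C a) * hc
  | succ i ih =>
    rw [evenPochhammer_succ, mul_comp, ih, evenPochhammer_succ]
    simp only [sub_comp, add_comp, one_comp, pow_comp, X_comp, C_comp, C_pow, C_sub, C_add,
      Nat.cast_succ, C_1]
    linear_combination (evenPochhammer a i * ((X + C a + C (i : ℚ)) * (X - C a + 1))) *
      (X + C a + C (i : ℚ) + 1) * hc

theorem evenPochhammer_comp_sub_half (a : ℚ) (i : ℕ) :
    (evenPochhammer (a - 1 / 2) (i + 1)).comp (X - C (1 / 2)) =
      evenPochhammer a i * ((X - C a - C (i : ℚ)) * (X + C a - 1)) := by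
  have h := congrArg (fun f : ℚ[X] => f.comp (-X)) (evenPochhammer_comp_add_half a i)
  simp only [comp_assoc, mul_comp, evenPochhammer_comp_neg] at h
  rw [← evenPochhammer_comp_neg (a - 1 / 2), comp_assoc]
  have h0 : (X + C (1 / 2) : ℚ[X]).comp (-X) = -(X - C (1 / 2)) := by
    simp only [add_comp, X_comp, C_comp]; ring
  have h1 : (X + C a + C (i : ℚ)).comp (-X) = -(X - C a - C (i : ℚ)) := by
    simp only [add_comp, X_comp, C_comp]; ring
  have h2 : (X - C a + 1).comp (-X) = -(X + C a - 1) := by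
    simp only [add_comp, sub_comp, one_comp, X_comp, C_comp]; ring
  rw [h1, h2, neg_mul_neg] at h
  rw [← h, h0, neg_comp, X_comp]

/-- Since `a - 1/2` and `b - 1/2` both square to `s² / 4`, the product of the two half-shifted
polynomials has double zeros at `± s / 2`, so `L` kills its central difference. -/
theorem derivSum_recurrence (s i j : ℕ) (a b : ℚ) (hab : a + b = 1)
    (ha : (2 * a - 1) ^ 2 = (s : ℚ) ^ 2) :
    ((i : ℚ) + j + 2) * derivSum s (X * (evenPochhammer a (i + 1) * evenPochhammer b j)) =
      -((2 * a + i) * (i + 1)) * (i + j + 1) *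
        derivSum s (X * (evenPochhammer a i * evenPochhammer b j)) := by
  obtain ⟨h₁, hh₁⟩ := evenPochhammer_succ_eq_mul (a - 1 / 2) i
  obtain ⟨h₂, hh₂⟩ := evenPochhammer_succ_eq_mul (b - 1 / 2) j
  have e1 : (a - 1 / 2) ^ 2 = (s : ℚ) ^ 2 / 4 := by linear_combination ha / 4
  have hb : b = 1 - a := by linear_combination hab
  have e2 : (b - 1 / 2) ^ 2 = (s : ℚ) ^ 2 / 4 := by rw [hb]; linear_combination ha / 4
  rw [e1] at hh₁
  rw [e2] at hh₂
  have key := derivSum_centralDiff s (h₁ * h₂)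
    (evenPochhammer (a - 1 / 2) (i + 1) * evenPochhammer (b - 1 / 2) (j + 1))
    (by rw [hh₁, hh₂]; ring)
  rw [mul_comp, mul_comp, evenPochhammer_comp_add_half, evenPochhammer_comp_add_half,
    evenPochhammer_comp_sub_half, evenPochhammer_comp_sub_half] at key
  -- The two quartic cofactors are reflections of each other, so only `X` times a quadratic in
  -- `X²`-form survives; writing `X² = (X² - (a + i)²) + (a + i)²` yields the two terms.
  have hp : evenPochhammer a i * ((X + C a + C (i : ℚ)) * (X - C a + 1)) *
        (evenPochhammer b j * ((X + C b + C (j : ℚ)) * (X - C b + 1))) -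
      evenPochhammer a i * ((X - C a - C (i : ℚ)) * (X + C a - 1)) *
        (evenPochhammer b j * ((X - C b - C (j : ℚ)) * (X + C b - 1))) =
      (2 * ((i : ℚ) + j + 2)) • (X * (evenPochhammer a (i + 1) * evenPochhammer b j)) +
      (2 * ((2 * a + i) * (i + 1) * (i + j + 1))) •
        (X * (evenPochhammer a i * evenPochhammer b j)) := by
    rw [evenPochhammer_succ, smul_eq_C_mul, smul_eq_C_mul]
    have hb' : (C b : ℚ[X]) = 1 - C a := by rw [hb]; simp
    simp only [C_mul, C_add, C_pow, hb', C_1, show (C 2 : ℚ[X]) = 2 from rfl]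
    ring
  rw [hp, map_add, map_smul, map_smul, smul_eq_mul, smul_eq_mul] at key
  linear_combination key / 2

theorem derivSum_X_mul (s i j : ℕ) (a b : ℚ) (hab : a + b = 1)
    (ha : (2 * a - 1) ^ 2 = (s : ℚ) ^ 2) :
    derivSum s (X * (evenPochhammer a i * evenPochhammer b j)) =
      s * (∏ l ∈ Finset.range i, -((2 * a + l) * (l + 1))) *
        (∏ l ∈ Finset.range j, -((2 * b + l) * (l + 1))) / (i + j + 1) := by
  induction i with
  | zero =>
    induction j with
    | zero => simp [evenPochhammer, derivSum_apply]
    | succ j ih =>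
      -- The hypotheses are symmetric in `a` and `b`, so the recurrence also raises `j`.
      have h := derivSum_recurrence s j 0 b a (by linarith)
        (by rw [show b = 1 - a by linarith]; linear_combination ha)
      rw [mul_comm (evenPochhammer b _), mul_comm (evenPochhammer b _), ih] at h
      rw [Finset.prod_range_succ, eq_div_iff (by positivity)]
      push_cast at h ⊢
      simp only [zero_add, add_zero] at h ⊢
      have : (j : ℚ) + 1 ≠ 0 := by positivity
      field_simp at h ⊢
      linear_combination h
  | succ i ih =>
    have h := derivSum_recurrence s i j a b hab ha
    rw [ih] at h
    rw [Finset.prod_range_succ, eq_div_iff (by positivity)]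
    push_cast at h ⊢
    have : (i : ℚ) + j + 1 ≠ 0 := by positivity
    field_simp at h ⊢
    linear_combination h

/-! ### Reduction of the Hankel determinants to Hilbert determinants -/

/-- The basis adapted to `derivSum`: even polynomials at even indices, odd ones at odd indices. -/
noncomputable def parityBasis (s k : ℕ) : ℚ[X] :=
  if Even k then evenPochhammer ((1 + s) / 2) (k / 2)
  else X * evenPochhammer ((1 - s) / 2) (k / 2)

theorem parityBasis_two_mul (s i : ℕ) :
    parityBasis s (2 * i) = evenPochhammer ((1 + s) / 2) i := by
  simp [parityBasis]

theorem parityBasis_two_mul_add_one (s i : ℕ) :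
    parityBasis s (2 * i + 1) = X * evenPochhammer ((1 - s) / 2) i := by
  rw [parityBasis, if_neg (by simp [parity_simps]), show (2 * i + 1) / 2 = i by omega]

theorem parityBasis_monic (s k : ℕ) : (parityBasis s k).Monic := by
  unfold parityBasis
  split_ifs
  · exact evenPochhammer_monic _ _
  · exact monic_X.mul (evenPochhammer_monic _ _)

theorem parityBasis_natDegree (s k : ℕ) : (parityBasis s k).natDegree = k := by
  obtain ⟨i, rfl | rfl⟩ := Nat.even_or_odd' k
  · rw [parityBasis_two_mul, evenPochhammer_natDegree]
  · rw [parityBasis_two_mul_add_one, monic_X.natDegree_mul (evenPochhammer_monic _ _),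
      evenPochhammer_natDegree, natDegree_X, add_comm]

theorem parityBasis_comp_neg (s k : ℕ) :
    (parityBasis s k).comp (-X) = (-1) ^ k * parityBasis s k := by
  obtain ⟨i, rfl | rfl⟩ := Nat.even_or_odd' k
  · simp [parityBasis_two_mul, evenPochhammer_comp_neg]
  · simp [parityBasis_two_mul_add_one, evenPochhammer_comp_neg, pow_succ]

theorem derivSum_parityBasis_of_even (s i j : ℕ) (h : Even (i + j)) :
    derivSum s (parityBasis s i * parityBasis s j) = 0 := by
  apply derivSum_eq_zero_of_even
  rw [mul_comp, parityBasis_comp_neg, parityBasis_comp_neg]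
  linear_combination (parityBasis s i * parityBasis s j) * (pow_add (-1 : ℚ[X]) i j).symm.trans
    h.neg_one_pow

theorem hankelDet_weightedPowerSum_eq (s n : ℕ) :
    hankelDet (weightedPowerSum s) n =
      (Matrix.of fun i j : Fin (n + 1) =>
        derivSum s (parityBasis s i * parityBasis s j)).det := by
  set c : ℚ := ((s : ℚ) + 1) / 2 with hc
  set L : ℚ[X] →ₗ[ℚ] ℚ := (derivSum s).comp (compRingHom (X + C c)).toAddMonoidHom.toRatLinearMap
    with hL
  have hLa : ∀ f, L f = derivSum s (f.comp (X + C c)) := fun f => rfl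
  have h := det_moment_eq_det_monic L (fun i : Fin (n + 1) => (parityBasis s i).comp (X - C c))
    (fun i => by rw [natDegree_comp, parityBasis_natDegree, natDegree_X_sub_C, mul_one])
    (fun i => (parityBasis_monic s i).comp_X_sub_C c)
  simp only [hLa, mul_comp, comp_assoc, X_pow_comp, sub_comp, X_comp, C_comp, add_sub_cancel_right,
    comp_X] at h
  rw [← h]
  simp only [hankelDet, weightedPowerSum_eq_derivSum, hc]

theorem hankelDet_weightedPowerSum_two_mul_add_one (s m : ℕ) :
    hankelDet (weightedPowerSum s) (2 * m + 1) =
      (-1) ^ (m + 1) * ((∏ i ∈ Finset.range (m + 1), (s : ℚ) *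
        (∏ l ∈ Finset.range i, -((2 * ((1 + s) / 2 : ℚ) + l) * (l + 1))) *
        (∏ l ∈ Finset.range i, -((2 * ((1 - s) / 2 : ℚ) + l) * (l + 1)))) *
        (Matrix.of fun i j : Fin (m + 1) => (1 : ℚ) / ((i : ℕ) + (j : ℕ) + 1)).det) ^ 2 := by
  set α : ℕ → ℚ := fun i => ∏ l ∈ Finset.range i, -((2 * ((1 + s) / 2 : ℚ) + l) * (l + 1))
    with hα
  set β : ℕ → ℚ := fun i => ∏ l ∈ Finset.range i, -((2 * ((1 - s) / 2 : ℚ) + l) * (l + 1))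
    with hβ
  rw [hankelDet_weightedPowerSum_eq, show 2 * m + 1 + 1 = 2 * (m + 1) by ring,
    Matrix.det_checkerboard_even (fun i j => derivSum s (parityBasis s i * parityBasis s j))
      (derivSum_parityBasis_of_even s)]
  -- The two off-diagonal blocks are transposes of each other, whence the square.
  have hT : (Matrix.of fun i j : Fin (m + 1) =>
      derivSum s (parityBasis s (2 * i + 1) * parityBasis s (2 * j))) =
      (Matrix.of fun i j : Fin (m + 1) =>
        derivSum s (parityBasis s (2 * i) * parityBasis s (2 * j + 1))).transpose := by
    ext i j
    simp [mul_comm]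
  have hE : (Matrix.of fun i j : Fin (m + 1) =>
      derivSum s (parityBasis s (2 * i) * parityBasis s (2 * j + 1))) =
      Matrix.of fun i j : Fin (m + 1) => s * α i * (β j * (1 / ((i : ℕ) + (j : ℕ) + 1))) := by
    ext i j
    have h := derivSum_X_mul s i j ((1 + s) / 2) ((1 - s) / 2) (by ring) (by ring)
    simp only [Matrix.of_apply, parityBasis_two_mul, parityBasis_two_mul_add_one]
    rw [mul_left_comm, h]
    ring
  have h3 := Matrix.det_mul_column (fun i : Fin (m + 1) => s * α i)
    (Matrix.of fun i j : Fin (m + 1) => β j * (1 / ((i : ℕ) + (j : ℕ) + 1)))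
  have h4 := Matrix.det_mul_row (fun i : Fin (m + 1) => β i)
    (Matrix.of fun i j : Fin (m + 1) => (1 : ℚ) / ((i : ℕ) + (j : ℕ) + 1))
  simp only [Matrix.of_apply] at h3 h4
  rw [hT, Matrix.det_transpose, hE, h3, h4, Finset.prod_mul_distrib (f := fun i => s * α i),
    Fin.prod_univ_eq_prod_range (fun i => s * α i), Fin.prod_univ_eq_prod_range β]
  ring

/-! ### The product formula -/

/-- The successive quotients of the (signed) block determinants. -/
theorem prod_hilbert_quotient (s n : ℕ) :
    (∏ l ∈ Finset.range n, -((2 * ((1 + s) / 2 : ℚ) + l) * (l + 1))) *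
        (∏ l ∈ Finset.range n, -((2 * ((1 - s) / 2 : ℚ) + l) * (l + 1))) *
      (1 / (2 * n + 1) * (∏ i ∈ Finset.range n, ((n : ℚ) - i) / (n + i + 1)) ^ 2) =
      (-1) ^ n * ∏ l ∈ Finset.Icc 1 n,
          ((l : ℚ) ^ 4 * ((s : ℚ) ^ 2 - (l : ℚ) ^ 2) /
            (4 * (2 * (l : ℚ) + 1) * (2 * (l : ℚ) - 1))) := by
  -- This is the reciprocal of the central binomial coefficient.
  have hq : ∀ n : ℕ, ∏ i ∈ Finset.range n, ((n : ℚ) - i) / (n + i + 1) =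
      (n.factorial : ℚ) ^ 2 / (2 * n).factorial := by
    intro n
    have h1 : ∏ i ∈ Finset.range n, ((n : ℚ) - i) = n.factorial := by
      rw [← Finset.prod_range_reflect, ← Finset.prod_range_add_one_eq_factorial]
      push_cast
      refine Finset.prod_congr rfl fun i hi => ?_
      rw [Finset.mem_range] at hi
      rw [Nat.sub_sub, Nat.cast_sub (by omega)]
      push_cast
      ring
    have h2 : (n.factorial : ℚ) * ∏ i ∈ Finset.range n, ((n : ℚ) + i + 1) =
        (2 * n).factorial := by
      rw [two_mul, ← Nat.factorial_mul_ascFactorial, Nat.ascFactorial_eq_prod_range]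
      push_cast
      congr 1
      exact Finset.prod_congr rfl fun i _ => by ring
    rw [Finset.prod_div_distrib, h1, ← h2]
    have : (n.factorial : ℚ) ≠ 0 := by positivity
    rw [pow_two, mul_div_mul_left _ _ this]
  rw [hq]
  induction n with
  | zero => simp
  | succ n ih =>
    rw [Finset.prod_Icc_succ_top (by omega), pow_succ (-1 : ℚ), Finset.prod_range_succ,
      Finset.prod_range_succ]
    have h2 : ((2 * (n + 1)).factorial : ℚ) = (2 * n + 2) * ((2 * n + 1) * (2 * n).factorial) := by
      rw [show 2 * (n + 1) = 2 * n + 1 + 1 by ring, Nat.factorial_succ, Nat.factorial_succ]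
      push_cast
      ring
    have h3 : (2 * ((n + 1 : ℕ) : ℚ) - 1) = 2 * n + 1 := by push_cast; ring
    rw [h2, h3, Nat.factorial_succ]
    have h4 : ((2 * n).factorial : ℚ) ≠ 0 := by positivity
    push_cast
    set A := ∏ l ∈ Finset.range n, -((2 * ((1 + s) / 2 : ℚ) + l) * (l + 1))
    set B := ∏ l ∈ Finset.range n, -((2 * ((1 - s) / 2 : ℚ) + l) * (l + 1))
    set P := ∏ l ∈ Finset.Icc 1 n, ((l : ℚ) ^ 4 * ((s : ℚ) ^ 2 - (l : ℚ) ^ 2) /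
      (4 * (2 * (l : ℚ) + 1) * (2 * (l : ℚ) - 1)))
    set r : ℚ := -(((n : ℚ) + 1) ^ 4 * ((s : ℚ) ^ 2 - ((n : ℚ) + 1) ^ 2) /
      (4 * (2 * ((n : ℚ) + 1) + 1) * (2 * n + 1))) with hr
    rw [show (-1 : ℚ) ^ n * -1 * (P * (((n : ℚ) + 1) ^ 4 * ((s : ℚ) ^ 2 - ((n : ℚ) + 1) ^ 2) /
      (4 * (2 * ((n : ℚ) + 1) + 1) * (2 * n + 1)))) = (-1) ^ n * P * r by rw [hr]; ring, ← ih, hr]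
    field_simp
    ring

theorem corollary3p7 (s : ℕ) (hs : 1 ≤ s) (m : ℕ) :
    hankelDet (weightedPowerSum s) (2 * m) = 0 ∧
    hankelDet (weightedPowerSum s) (2 * m + 1) =
      (-(s : ℚ) ^ 2) ^ (m + 1) *
        ∏ l ∈ Finset.Icc 1 m,
          ((l : ℚ) ^ 4 * ((s : ℚ) ^ 2 - (l : ℚ) ^ 2) /
            (4 * (2 * (l : ℚ) + 1) * (2 * (l : ℚ) - 1))) ^ (2 * (m + 1 - l)) ∧
    (s ≤ m → hankelDet (weightedPowerSum s) (2 * m + 1) = 0) := by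
  have hodd : hankelDet (weightedPowerSum s) (2 * m + 1) =
      (-(s : ℚ) ^ 2) ^ (m + 1) *
        ∏ l ∈ Finset.Icc 1 m,
          ((l : ℚ) ^ 4 * ((s : ℚ) ^ 2 - (l : ℚ) ^ 2) /
            (4 * (2 * (l : ℚ) + 1) * (2 * (l : ℚ) - 1))) ^ (2 * (m + 1 - l)) := by
    rw [hankelDet_weightedPowerSum_two_mul_add_one]
    induction m with
    | zero => simp
    | succ m ih =>
      rw [Finset.prod_range_succ, Matrix.det_hilbert_succ]
      have hq := prod_hilbert_quotient s (m + 1)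
      set Λ : ℕ → ℚ := fun l => (l : ℚ) ^ 4 * ((s : ℚ) ^ 2 - (l : ℚ) ^ 2) /
            (4 * (2 * (l : ℚ) + 1) * (2 * (l : ℚ) - 1)) with hΛ
      -- Raising `m` by one adds 2 to every exponent, the new factor `l = m + 1` starting from
      -- exponent 0.
      have hp : ∏ l ∈ Finset.Icc 1 (m + 1), Λ l ^ (2 * (m + 1 + 1 - l)) =
          (∏ l ∈ Finset.Icc 1 m, Λ l ^ (2 * (m + 1 - l))) *
            (∏ l ∈ Finset.Icc 1 (m + 1), Λ l) ^ 2 := by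
        rw [Finset.prod_Icc_succ_top (by omega), Finset.prod_Icc_succ_top (by omega), mul_pow,
          ← mul_assoc, ← Finset.prod_pow, ← Finset.prod_mul_distrib]
        congr 1
        · refine Finset.prod_congr rfl fun l hl => ?_
          rw [Finset.mem_Icc] at hl
          rw [← pow_add]
          congr 1
          omega
        · congr 1
          omega
      have hs1 : ((-1 : ℚ) ^ (m + 1)) ^ 2 = 1 := by rw [← pow_mul]; simp
      rw [hp]
      set D := ∏ i ∈ Finset.range (m + 1), (s : ℚ) *
        (∏ l ∈ Finset.range i, -((2 * ((1 + s) / 2 : ℚ) + l) * (l + 1))) *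
        (∏ l ∈ Finset.range i, -((2 * ((1 - s) / 2 : ℚ) + l) * (l + 1)))
      set A := ∏ l ∈ Finset.range (m + 1), -((2 * ((1 + s) / 2 : ℚ) + l) * (l + 1))
      set B := ∏ l ∈ Finset.range (m + 1), -((2 * ((1 - s) / 2 : ℚ) + l) * (l + 1))
      set T := ∏ l ∈ Finset.Icc 1 (m + 1), Λ l
      set q := 1 / (2 * ((m + 1 : ℕ) : ℚ) + 1) *
        (∏ i ∈ Finset.range (m + 1), (((m + 1 : ℕ) : ℚ) - i) / ((m + 1 : ℕ) + i + 1)) ^ 2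
      have hq2 : (A * B * q) ^ 2 = T ^ 2 := by rw [hq, mul_pow, hs1, one_mul]
      rw [pow_succ (-1 : ℚ), pow_succ (-(s : ℚ) ^ 2)]
      linear_combination (-(s : ℚ) ^ 2 * T ^ 2) * ih +
        (-(s : ℚ) ^ 2 * ((-1) ^ (m + 1) * (D * (Matrix.of fun i j : Fin (m + 1) =>
          (1 : ℚ) / ((i : ℕ) + (j : ℕ) + 1)).det) ^ 2)) * hq2
  refine ⟨?_, hodd, fun hsm => ?_⟩
  · rw [hankelDet_weightedPowerSum_eq]
    exact Matrix.det_checkerboard_odd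
      (fun i j => derivSum s (parityBasis s i * parityBasis s j))
      (derivSum_parityBasis_of_even s) m
  -- The factor `l = s` vanishes, its exponent being positive because `s ≤ m`.
  · rw [hodd, Finset.prod_eq_zero (Finset.mem_Icc.2 ⟨hs, hsm⟩), mul_zero]
    rw [sub_self, mul_zero, zero_div, zero_pow (by omega)]
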